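/- Let $d\ge 1$, $\alpha>1$ and $1\le p\le\infty$, and let $W_\alpha(x)=e^{-|x|^\alpha}$ for $x\in\mathbb R^d$, where $|\cdot|$ is the Euclidean norm. For an integer $n\ge 0$ let $\Pi_{n,d}^{(2)}$ be the set of all real algebraic polynomials in $d$ variables of total degree at most $n$ that are convex on $\mathbb R^d$. Suppose that $f:\mathbb R^d\to\mathbb R$ is convex on $\mathbb R^d$ and, in addition, that $fW_\alpha\in L_p(\mathbb R^d)$ if $1\le p<\infty$, or that $f$ is continuous with $\lim_{|x|\to\infty}f(x)W_\alpha(x)=0$ if $p=\infty$. Then $$\inf_{P\in\Pi_{n,d}^{(2)}}\|(f-P)W_\alpha\|_{L_p(\mathbb R^d)}\to 0,\qquad n\to\infty,$$ where $\|\cdot\|_{L_p(\mathbb R^d)}$ is the usual $L_p$ norm with respect to Lebesgue measure (the essential supremum of the absolute value if $p=\infty$). -/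

import Mathlib

open MeasureTheory Filter Topology
open scoped ENNReal

/-- The Freud weight `W_α(x) = exp(-|x|^α)` on `ℝ^d`, with `|x|` the Euclidean norm. -/
noncomputable def freudWeight (d : ℕ) (α : ℝ) (x : EuclideanSpace ℝ (Fin d)) : ℝ :=
  Real.exp (-(‖x‖ ^ α))

/-- The class `C_W(ℝ^d)`: continuous real functions `f` with `f(x) W(x) → 0` as `|x| → ∞`. -/
def weightedC0 (d : ℕ) (W : EuclideanSpace ℝ (Fin d) → ℝ) :
    Set (EuclideanSpace ℝ (Fin d) → ℝ) :=
  {f | Continuous f ∧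
    Tendsto (fun x => f x * W x) (comap (fun x => ‖x‖) atTop) (𝓝 0)}

/-- The function on `ℝ^d` given by a real polynomial in `d` variables. -/
noncomputable def polyFun {d : ℕ} (P : MvPolynomial (Fin d) ℝ)
    (x : EuclideanSpace ℝ (Fin d)) : ℝ :=
  MvPolynomial.eval (fun i => x i) P

/-- Real polynomials in `d` variables of total degree at most `n` that are convex on
all of `ℝ^d`. -/
def convexPolys (n d : ℕ) : Set (MvPolynomial (Fin d) ℝ) :=
  {P | P.totalDegree ≤ n ∧ ConvexOn ℝ Set.univ (polyFun P)}

/-- The error `inf_P ‖(f - P) W‖_{L_p(ℝ^d)}` of weighted approximation of `f` by polynomials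
`P` of total degree at most `n` convex on `ℝ^d`, as an extended nonnegative real. -/
noncomputable def convexApproxError (n d : ℕ) (p : ℝ≥0∞) (W : EuclideanSpace ℝ (Fin d) → ℝ)
    (f : EuclideanSpace ℝ (Fin d) → ℝ) : ℝ≥0∞ :=
  ⨅ P ∈ convexPolys n d, eLpNorm (fun x => (f x - polyFun P x) * W x) p volume

/-! ### Growth of the reciprocal of the square root of the weight -/

/-! Put `V = exp(|x|^α / 2)`. Then `V * W_α = exp(-|x|^α / 2)` lies in every `L_p`, so a pointwise
error at most `ε V` is enough. Since `α > 1`, `V` dominates every `exp(A |x|)`.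

A convex `f` is the increasing limit of finite maxima of affine functions, and these converge to `f`
in the weighted norm. It remains to treat a convex `g` of linear growth. Up to a constant and a
small error, `g` is `max(g + C₀, |x|²) = |x|² + u` with `u` continuous of compact support in a ball
`S`. Convexity of `u` fails by at most `a b |x - y|²`, and only at points of `S`.

Convolve `u` with a nonnegative polynomial kernel `k`, a Taylor truncation of `c sinc(N|x|)^(2d)`.
The result is a polynomial, whose convexity at a point `w` fails by at most `a b |x - y|²` times the
local mass `∫_S k(w - z) dz`. For bounded `w` this mass is at most `1 + δ`, compensated by `(1 +
δ)|x|²`. For large `w` the truncation is uncontrolled, and a convex radial polynomial `|x|² φ(|x|²)`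
compensates (`norm_sq_mul_strongly_convex`). Its smallness against `V` rests on a bound for the
truncations that is exponential in `|x|` and uniform in their degree (`sincMajorant_sq_le_exp`), so
its size can be fixed before the degree. The construction is
`exists_convex_polyFun_near_norm_sq_add`. -/

theorem exp_mul_le_mul_exp_rpow {α : ℝ} (hα : 1 < α) (A : ℝ) :
    ∃ C > 0, ∀ r : ℝ, 0 ≤ r → Real.exp (A * r) ≤ C * Real.exp (r ^ α / 2) := by
  set B := max (2 * A) 1 with hB
  have hB1 : 1 ≤ B := le_max_right _ _
  -- Solves `r₀ ^ (α - 1) = B`, so that `r ^ α ≥ B * r ≥ 2 * A * r` beyond `r₀`.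
  set r₀ := B ^ (1 / (α - 1)) with hr₀
  have hr₀1 : 0 < r₀ := by positivity
  refine ⟨Real.exp (B * r₀ / 2), Real.exp_pos _, fun r hr => ?_⟩
  rw [← Real.exp_add]
  refine Real.exp_le_exp.2 ?_
  have hA : A * r ≤ B / 2 * r :=
    mul_le_mul_of_nonneg_right (by linarith [le_max_left (2 * A) 1]) hr
  rcases le_total r r₀ with h | h
  · have h1 : 0 ≤ r ^ α := by positivity
    have h2 : B / 2 * r ≤ B / 2 * r₀ := by gcongr
    linarith
  · have hrpos : 0 < r := hr₀1.trans_le h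
    have h1 : B ≤ r ^ (α - 1) := by
      calc B = r₀ ^ (α - 1) := by
            rw [hr₀, ← Real.rpow_mul (by linarith), one_div, inv_mul_cancel₀ (by linarith),
              Real.rpow_one]
        _ ≤ r ^ (α - 1) := Real.rpow_le_rpow hr₀1.le h (by linarith)
    have h2 : r ^ α = r ^ (α - 1) * r := by
      rw [Real.rpow_sub_one hrpos.ne', div_mul_cancel₀ _ hrpos.ne']
    have h3 : B * r ≤ r ^ α := by rw [h2]; gcongr
    have h4 : 0 ≤ B * r₀ := by positivity
    linarith

theorem exp_mul_le_small_mul_exp_rpow {α : ℝ} (hα : 1 < α) (A : ℝ) {ε : ℝ} (hε : 0 < ε) :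
    ∃ R > 0, ∀ r : ℝ, R ≤ r → Real.exp (A * r) ≤ ε * Real.exp (r ^ α / 2) := by
  -- The spare unit in the exponent leaves a factor `exp (-r)`, which absorbs `C / ε`.
  obtain ⟨C, hC, h⟩ := exp_mul_le_mul_exp_rpow hα (A + 1)
  obtain ⟨R, hR⟩ := ((Real.tendsto_exp_neg_atTop_nhds_zero.const_mul C).eventually
    (ge_mem_nhds (by simpa using hε : C * 0 < ε))).exists_forall_of_atTop
  refine ⟨max R 1, by positivity, fun r hr => ?_⟩
  have h1 : R ≤ r := (le_max_left _ _).trans hr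
  have h2 : 1 ≤ r := (le_max_right _ _).trans hr
  calc Real.exp (A * r) = Real.exp (-r) * Real.exp ((A + 1) * r) := by
        rw [← Real.exp_add]; ring_nf
    _ ≤ Real.exp (-r) * (C * Real.exp (r ^ α / 2)) := by gcongr; exact h r (by linarith)
    _ = (C * Real.exp (-r)) * Real.exp (r ^ α / 2) := by ring
    _ ≤ ε * Real.exp (r ^ α / 2) := by gcongr; exact hR r h1

theorem exp_mul_le_small_mul_exp_rpow_add {α : ℝ} (hα : 1 < α) {A : ℝ} (hA : 0 ≤ A)
    {ε : ℝ} (hε : 0 < ε) :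
    ∃ C > 0, ∀ r : ℝ, 0 ≤ r → Real.exp (A * r) ≤ ε * Real.exp (r ^ α / 2) + C := by
  obtain ⟨R, hR, h⟩ := exp_mul_le_small_mul_exp_rpow hα A hε
  refine ⟨Real.exp (A * R), Real.exp_pos _, fun r hr => ?_⟩
  rcases le_total R r with h1 | h1
  · linarith [h r h1, Real.exp_pos (A * R)]
  · have : Real.exp (A * r) ≤ Real.exp (A * R) := by gcongr
    have : 0 < ε * Real.exp (r ^ α / 2) := by positivity
    linarith

theorem one_le_exp_rpow_div_two (α : ℝ) {r : ℝ} (hr : 0 ≤ r) : 1 ≤ Real.exp (r ^ α / 2) :=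
  Real.one_le_exp (by positivity)

theorem le_exp_self (r : ℝ) : r ≤ Real.exp r := by linarith [Real.add_one_le_exp r]

theorem memLp_exp_neg_norm_rpow {d : ℕ} {α : ℝ} (hα : 1 < α) {p : ℝ≥0∞} (hp : 1 ≤ p) :
    MemLp (fun x : EuclideanSpace ℝ (Fin d) => Real.exp (-(‖x‖ ^ α / 2))) p volume := by
  have hcont : Continuous fun x : EuclideanSpace ℝ (Fin d) => Real.exp (-(‖x‖ ^ α / 2)) := by
    have := (Real.continuous_rpow_const (by linarith : 0 ≤ α)).comp
      (continuous_norm (E := EuclideanSpace ℝ (Fin d)))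
    fun_prop
  have hle : ∀ x : EuclideanSpace ℝ (Fin d), Real.exp (-(‖x‖ ^ α / 2)) ≤ 1 := fun x =>
    Real.exp_le_one_iff.2 (by have : 0 ≤ ‖x‖ ^ α := by positivity
                              linarith)
  rcases eq_or_ne p ∞ with rfl | hp'
  · exact memLp_top_of_bound hcont.aestronglyMeasurable 1
      (.of_forall fun x => by rw [Real.norm_of_nonneg (Real.exp_pos _).le]; exact hle x)
  · have hp1 : 1 ≤ p.toReal := by
      rw [← ENNReal.toReal_one]; exact ENNReal.toReal_mono hp' hp
    rw [← integrable_norm_rpow_iff hcont.aestronglyMeasurable (by positivity) hp']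
    -- The comparison function is `(1 + ‖x‖) ^ (-(d + 1))`, integrable since `d + 1 > d`.
    obtain ⟨C, hC, h⟩ := exp_mul_le_mul_exp_rpow hα (d + 1)
    have hint := (integrable_one_add_norm (μ := (volume : Measure (EuclideanSpace ℝ (Fin d))))
      (r := d + 1) (by simp)).const_mul C
    refine hint.mono' ?_ (.of_forall fun x => ?_)
    · exact (Continuous.rpow_const hcont.norm fun x => Or.inr (by positivity)).aestronglyMeasurable
    · rw [Real.norm_of_nonneg (by positivity), Real.norm_of_nonneg (Real.exp_pos _).le]
      calc Real.exp (-(‖x‖ ^ α / 2)) ^ p.toReal ≤ Real.exp (-(‖x‖ ^ α / 2)) ^ (1 : ℝ) :=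
            Real.rpow_le_rpow_of_exponent_ge (Real.exp_pos _) (hle x) hp1
        _ = (Real.exp (‖x‖ ^ α / 2))⁻¹ := by rw [Real.rpow_one, Real.exp_neg]
        _ ≤ C * (Real.exp ((d + 1) * ‖x‖))⁻¹ := by
            rw [← div_eq_mul_inv, le_div_iff₀ (Real.exp_pos _), inv_mul_le_iff₀ (Real.exp_pos _),
              mul_comm (Real.exp (‖x‖ ^ α / 2))]
            exact h _ (norm_nonneg x)
        _ ≤ C * (1 + ‖x‖) ^ (-(d + 1 : ℝ)) := by
            gcongr
            rw [Real.rpow_neg (by positivity), mul_comm (d + 1 : ℝ), Real.exp_mul]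
            gcongr
            linarith [Real.add_one_le_exp ‖x‖]

/-! ### The function `sinc` and the partial sums of its Taylor series -/

/-- Partial sums, in the variable `τ = r ^ 2`, of the Taylor series of `sinc r`. -/
noncomputable def sincTrunc (m : ℕ) (τ : ℝ) : ℝ :=
  ∑ k ∈ Finset.range m, (-1) ^ k / ((2 * k + 1).factorial : ℝ) * τ ^ k

/-- The partial sums of the Taylor series of `sinc` with all coefficients made positive. -/
noncomputable def sincMajorant (m : ℕ) (τ : ℝ) : ℝ :=
  ∑ k ∈ Finset.range m, 1 / ((2 * k + 1).factorial : ℝ) * τ ^ k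

theorem abs_sincTrunc_le (m : ℕ) {τ : ℝ} (hτ : 0 ≤ τ) : |sincTrunc m τ| ≤ sincMajorant m τ := by
  refine (Finset.abs_sum_le_sum_abs _ _).trans (Finset.sum_le_sum fun k _ => le_of_eq ?_)
  rw [abs_mul, abs_div, abs_pow, abs_neg, abs_one, one_pow, abs_of_nonneg (pow_nonneg hτ k),
    Nat.abs_cast]

theorem sincMajorant_nonneg (m : ℕ) {τ : ℝ} (hτ : 0 ≤ τ) : 0 ≤ sincMajorant m τ :=
  Finset.sum_nonneg fun k _ => by positivity

theorem sincMajorant_mono (m : ℕ) {σ τ : ℝ} (hσ : 0 ≤ σ) (h : σ ≤ τ) :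
    sincMajorant m σ ≤ sincMajorant m τ :=
  Finset.sum_le_sum fun k _ => by gcongr

theorem convexOn_sincMajorant (m : ℕ) : ConvexOn ℝ (Set.Ici 0) (sincMajorant m) := by
  have : sincMajorant m
      = ∑ k ∈ Finset.range m, fun τ : ℝ => (1 / ((2 * k + 1).factorial : ℝ)) • τ ^ k := by
    ext τ; simp [sincMajorant]
  rw [this]
  induction Finset.range m using Finset.induction_on with
  | empty => exact convexOn_const (0 : ℝ) (convex_Ici 0)
  | insert k s hk ih =>
    rw [Finset.sum_insert hk]
    refine ConvexOn.add ?_ ih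
    exact (convexOn_pow k).smul (by positivity)

/-- Termwise comparison with the series of `cosh r`. Independence of `m` is the point: the
correction term can be made small before the degree is chosen. -/
theorem sincMajorant_sq_le_exp (m : ℕ) {r : ℝ} (hr : 0 ≤ r) :
    sincMajorant m (r ^ 2) ≤ Real.exp r := by
  have h1 : sincMajorant m (r ^ 2) ≤ ∑ k ∈ Finset.range m, r ^ (2 * k) / ((2 * k).factorial : ℝ) := by
    refine Finset.sum_le_sum fun k _ => ?_
    rw [← pow_mul, one_div, inv_mul_eq_div]
    gcongr
    omega
  refine h1.trans ?_
  have h2 := Real.hasSum_cosh r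
  refine (sum_le_hasSum (Finset.range m) (fun k _ => by positivity) h2).trans ?_
  rw [Real.cosh_eq]
  have : Real.exp (-r) ≤ Real.exp r := Real.exp_le_exp.2 (by linarith)
  linarith

theorem tendstoUniformlyOn_sincTrunc (R : ℝ) :
    TendstoUniformlyOn (fun m r => sincTrunc m (r ^ 2)) Real.sinc atTop (Set.Icc 0 R) := by
  have hsum : ∀ r : ℝ, ∑' k : ℕ, (-1) ^ k / ((2 * k + 1).factorial : ℝ) * (r ^ 2) ^ k
      = Real.sinc r := by
    intro r
    rcases eq_or_ne r 0 with rfl | hr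
    · rw [tsum_eq_single 0 (fun k hk => by simp [hk])]
      simp
    · rw [Real.sinc_of_ne_zero hr]
      refine HasSum.tsum_eq ?_
      refine ((Real.hasSum_sin r).div_const r).congr_fun ?_
      intro k
      field_simp
      ring
  have hu : Summable fun k : ℕ => 1 / ((2 * k + 1).factorial : ℝ) * (R ^ 2) ^ k := by
    have h := (Real.hasSum_cosh R).summable
    refine Summable.of_nonneg_of_le (fun k => by positivity) (fun k => ?_) h
    rw [← pow_mul, one_div, inv_mul_eq_div]
    have : 0 ≤ R ^ (2 * k) := by rw [pow_mul]; positivity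
    gcongr
    omega
  have := tendstoUniformlyOn_tsum_nat
    (f := fun k (r : ℝ) => (-1) ^ k / ((2 * k + 1).factorial : ℝ) * (r ^ 2) ^ k)
    (s := Set.Icc 0 R) hu (fun k r hr => by
      rw [norm_mul, norm_div, norm_pow, norm_neg, norm_one, one_pow, norm_pow, norm_pow,
        Real.norm_of_nonneg hr.1, Real.norm_of_nonneg (by positivity)]
      have := hr.1
      have := hr.2
      gcongr)
  refine this.congr_right fun r _ => hsum r

theorem exists_sincTrunc_pow_near (j : ℕ) (R : ℝ) {ε : ℝ} (hε : 0 < ε) :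
    ∃ m, ∀ r ∈ Set.Icc 0 R, |sincTrunc m (r ^ 2) ^ j - Real.sinc r ^ j| ≤ ε := by
  have huc : UniformContinuousOn (fun t : ℝ => t ^ j) (Set.Icc (-2) 2) :=
    isCompact_Icc.uniformContinuousOn_of_continuous (by fun_prop)
  obtain ⟨δ, hδ, h⟩ := Metric.uniformContinuousOn_iff.1 huc ε hε
  obtain ⟨m, hm⟩ := (Metric.tendstoUniformlyOn_iff.1 (tendstoUniformlyOn_sincTrunc R)
    (min δ 1) (by positivity)).exists
  refine ⟨m, fun r hr => ?_⟩
  have h1 := hm r hr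
  have h2 : |Real.sinc r - sincTrunc m (r ^ 2)| < min δ 1 := h1
  have h3 := lt_min_iff.1 h2
  have h4 := abs_lt.1 h3.2
  have h5 := Real.sinc_le_one r
  have h6 := Real.neg_one_le_sinc r
  have := h (sincTrunc m (r ^ 2)) ⟨by linarith, by linarith⟩ (Real.sinc r)
    ⟨by linarith, by linarith⟩ (by rw [dist_comm]; exact h3.1)
  exact this.le

theorem sinc_sq_le (r : ℝ) : Real.sinc r ^ 2 ≤ 2 * (1 + r ^ 2)⁻¹ := by
  rw [← div_eq_mul_inv, le_div_iff₀ (by positivity)]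
  have h1 : Real.sinc r ^ 2 ≤ 1 := by
    rw [← sq_abs]; exact pow_le_one₀ (abs_nonneg _) (Real.abs_sinc_le_one r)
  have h2 : Real.sinc r ^ 2 * r ^ 2 ≤ 1 := by
    rcases eq_or_ne r 0 with rfl | hr
    · simp
    · rw [Real.sinc_of_ne_zero hr, div_pow, div_mul_cancel₀ _ (by positivity)]
      exact Real.sin_sq_le_one r
  linarith

/-- The power `2 * d` gives decay of order `‖x‖ ^ (-2 * d)`, enough in dimension `d ≥ 1`; being
even, it also makes the kernel and its truncations nonnegative. -/
theorem integrable_sinc_norm_pow {d : ℕ} (hd : 1 ≤ d) :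
    Integrable (fun x : EuclideanSpace ℝ (Fin d) => Real.sinc ‖x‖ ^ (2 * d)) volume := by
  have hint := (integrable_rpow_neg_one_add_norm_sq
    (μ := (volume : Measure (EuclideanSpace ℝ (Fin d)))) (r := 2 * d)
    (by simp only [finrank_euclideanSpace, Fintype.card_fin]
        have : (1 : ℝ) ≤ d := by exact_mod_cast hd
        linarith)).const_mul ((2 : ℝ) ^ d)
  have hc := Real.continuous_sinc
  refine hint.mono' (by fun_prop) (.of_forall fun x => ?_)
  rw [pow_mul, Real.norm_of_nonneg (by positivity)]
  calc (Real.sinc ‖x‖ ^ 2) ^ d ≤ (2 * (1 + ‖x‖ ^ 2)⁻¹) ^ d := by gcongr; exact sinc_sq_le _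
    _ = 2 ^ d * (1 + ‖x‖ ^ 2) ^ (-(2 * d : ℝ) / 2) := by
      rw [mul_pow, neg_div, mul_div_cancel_left₀ _ two_ne_zero, Real.rpow_neg (by positivity),
        Real.rpow_natCast, inv_pow]

theorem integral_sinc_norm_pow_pos {d : ℕ} (hd : 1 ≤ d) :
    0 < ∫ x : EuclideanSpace ℝ (Fin d), Real.sinc ‖x‖ ^ (2 * d) := by
  have hc := Real.continuous_sinc
  refine integral_pos_of_integrable_nonneg_nonzero (x := 0) (by fun_prop)
    (integrable_sinc_norm_pow hd) (fun x => ?_) (by simp)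
  rw [pow_mul]
  positivity

/-! ### Polynomial functions -/

/-- The algebra of polynomial functions on `ℝ^d`. -/
noncomputable def polyFunctions (d : ℕ) : Subalgebra ℝ (EuclideanSpace ℝ (Fin d) → ℝ) where
  carrier := Set.range polyFun
  mul_mem' := by
    rintro _ _ ⟨P, rfl⟩ ⟨Q, rfl⟩
    exact ⟨P * Q, by ext x; simp [polyFun]⟩
  add_mem' := by
    rintro _ _ ⟨P, rfl⟩ ⟨Q, rfl⟩
    exact ⟨P + Q, by ext x; simp [polyFun]⟩
  algebraMap_mem' r := ⟨MvPolynomial.C r, by ext x; simp [polyFun]⟩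

theorem const_mem_polyFunctions (d : ℕ) (c : ℝ) : (fun _ => c) ∈ polyFunctions d :=
  (polyFunctions d).algebraMap_mem c

theorem coord_mem_polyFunctions {d : ℕ} (i : Fin d) : (fun x => x i) ∈ polyFunctions d :=
  ⟨MvPolynomial.X i, by ext x; simp [polyFun]⟩

theorem norm_sq_mem_polyFunctions (d : ℕ) : (fun x => ‖x‖ ^ 2) ∈ polyFunctions d := by
  have : (fun x : EuclideanSpace ℝ (Fin d) => ‖x‖ ^ 2) = ∑ i : Fin d, (fun x => x i) ^ 2 := by
    ext x
    simp [EuclideanSpace.norm_sq_eq]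
  rw [this]
  exact sum_mem fun i _ => pow_mem (coord_mem_polyFunctions i) 2

theorem powerSum_comp_mem_polyFunctions {d : ℕ} {F : EuclideanSpace ℝ (Fin d) → ℝ}
    (hF : F ∈ polyFunctions d) (m : ℕ) (c : ℕ → ℝ) :
    (fun x => ∑ k ∈ Finset.range m, c k * F x ^ k) ∈ polyFunctions d := by
  have : (fun x => ∑ k ∈ Finset.range m, c k * F x ^ k)
      = ∑ k ∈ Finset.range m, (fun _ => c k) * F ^ k := by
    ext x; simp
  rw [this]
  exact sum_mem fun k _ => mul_mem (const_mem_polyFunctions d _) (pow_mem hF k)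

theorem continuous_polyFun {d : ℕ} (P : MvPolynomial (Fin d) ℝ) : Continuous (polyFun P) := by
  have := MvPolynomial.continuous_eval P
  unfold polyFun
  fun_prop

/-- The convolution of a compactly supported continuous function with a polynomial is a
polynomial. -/
theorem integral_mul_polyFun_sub_mem_polyFunctions {d : ℕ} (Q : MvPolynomial (Fin d) ℝ) :
    ∀ {u : EuclideanSpace ℝ (Fin d) → ℝ}, Continuous u → HasCompactSupport u →
      (fun x => ∫ y, u y * polyFun Q (x - y)) ∈ polyFunctions d := by
  have hint : ∀ {u : EuclideanSpace ℝ (Fin d) → ℝ}, Continuous u → HasCompactSupport u →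
      ∀ (P : MvPolynomial (Fin d) ℝ) x, Integrable (fun y => u y * polyFun P (x - y)) := by
    intro u hu hc P x
    have := continuous_polyFun P
    exact Continuous.integrable_of_hasCompactSupport (by fun_prop) hc.mul_right
  induction Q using MvPolynomial.induction_on with
  | C a =>
    intro u hu hc
    simpa [polyFun] using const_mem_polyFunctions d _
  | add P Q hP hQ =>
    intro u hu hc
    have : (fun x => ∫ y, u y * polyFun (P + Q) (x - y))
        = (fun x => ∫ y, u y * polyFun P (x - y)) + fun x => ∫ y, u y * polyFun Q (x - y) := by
      ext x
      rw [Pi.add_apply, ← integral_add (hint hu hc P x) (hint hu hc Q x)]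
      simp [polyFun, mul_add]
    rw [this]
    exact add_mem (hP hu hc) (hQ hu hc)
  | mul_X P i hP =>
    intro u hu hc
    -- In the new factor `x i - y i`, the part `y i` is absorbed into `u`; hence the induction runs
    -- over all `u` at once.
    have hu' : Continuous fun y => u y * y i := by fun_prop
    have hc' : HasCompactSupport fun y => u y * y i := hc.mul_right
    have : (fun x => ∫ y, u y * polyFun (P * MvPolynomial.X i) (x - y))
        = (fun x => x i) * (fun x => ∫ y, u y * polyFun P (x - y))
          - fun x => ∫ y, (u y * y i) * polyFun P (x - y) := by
      ext x
      rw [Pi.sub_apply, Pi.mul_apply, ← integral_const_mul,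
        ← integral_sub ((hint hu hc P x).const_mul _) (hint hu' hc' P x)]
      congr 1
      ext y
      simp [polyFun]
      ring
    rw [this]
    exact sub_mem (mul_mem (coord_mem_polyFunctions i) (hP hu hc)) (hP hu' hc')

/-! ### Convolutions -/

theorem integral_mul_comp_sub_left {d : ℕ} (u k : EuclideanSpace ℝ (Fin d) → ℝ)
    (x : EuclideanSpace ℝ (Fin d)) : ∫ y, u y * k (x - y) = ∫ z, u (x - z) * k z := by
  rw [← integral_sub_left_eq_self (fun z => u (x - z) * k z) volume x]
  simp

/-- Convolutions with a dilated integrable kernel approximate a compactly supported continuous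
function uniformly. -/
theorem exists_dilation_convolution_near {d : ℕ} {κ : EuclideanSpace ℝ (Fin d) → ℝ}
    (hκ : Integrable κ) (hI : 0 < ∫ x, κ x) {u : EuclideanSpace ℝ (Fin d) → ℝ}
    (hu : Continuous u) (hc : HasCompactSupport u) {ε : ℝ} (hε : 0 < ε) :
    ∃ N : ℝ, 0 < N ∧
      ∀ x, |(∫ y, u y * (N ^ d / (∫ z, κ z) * κ (N • (x - y)))) - u x| ≤ ε := by
  obtain ⟨M, hM⟩ := hc.exists_bound_of_continuous hu
  have huc : UniformContinuous u := hc.uniformContinuous_of_continuous hu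
  have key : ∀ (N : ℝ), 0 < N → ∀ x,
      (∫ y, u y * (N ^ d / (∫ z, κ z) * κ (N • (x - y)))) - u x
        = (∫ z, κ z)⁻¹ * ∫ w, (u (x - N⁻¹ • w) - u x) * κ w := by
    intro N hN x
    have h1 : Integrable fun w => u (x - N⁻¹ • w) * κ w := by
      refine hκ.bdd_mul (c := M) (by fun_prop) (.of_forall fun w => hM _)
    have h2 : ∫ w, (u (x - N⁻¹ • w) - u x) * κ w
        = (∫ w, u (x - N⁻¹ • w) * κ w) - u x * ∫ w, κ w := by
      rw [← integral_const_mul, ← integral_sub h1 (hκ.const_mul _)]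
      congr 1; ext w; ring
    have h3 : ∫ y, u y * (N ^ d / (∫ z, κ z) * κ (N • (x - y)))
        = N ^ d / (∫ z, κ z) * ∫ w, u (x - w) * κ (N • w) := by
      rw [← integral_mul_comp_sub_left u (fun w => κ (N • w)), ← integral_const_mul]
      congr 1; ext y; ring
    have h4 : ∫ w, u (x - w) * κ (N • w) = (N ^ d)⁻¹ * ∫ w, u (x - N⁻¹ • w) * κ w := by
      have := Measure.integral_comp_smul (volume : Measure (EuclideanSpace ℝ (Fin d)))
        (fun w => u (x - N⁻¹ • w) * κ w) N
      simp only [smul_smul, inv_mul_cancel₀ hN.ne', one_smul, finrank_euclideanSpace,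
        Fintype.card_fin, smul_eq_mul] at this
      rw [this, abs_of_nonneg (by positivity)]
    rw [h3, h4, h2]
    field_simp
  -- Failure for every `N = n + 1` gives bad points `x n`; dominated convergence along them
  -- contradicts uniform continuity of `u`.
  by_contra! hcon
  choose x hx using fun n : ℕ => hcon (n + 1) (by positivity)
  have hlim : Tendsto (fun n : ℕ => ∫ w, (u (x n - ((n : ℝ) + 1)⁻¹ • w) - u (x n)) * κ w) atTop
      (𝓝 (∫ _ : EuclideanSpace ℝ (Fin d), (0 : ℝ))) := by
    refine tendsto_integral_of_dominated_convergence (fun w => 2 * M * ‖κ w‖) (fun n => ?_)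
      (hκ.norm.const_mul _) (fun n => .of_forall fun w => ?_) (.of_forall fun w => ?_)
    · have h := hκ.aestronglyMeasurable
      exact (Continuous.aestronglyMeasurable (by fun_prop)).mul h
    · rw [norm_mul]
      gcongr
      exact (norm_sub_le _ _).trans (by linarith [hM (x n - ((n : ℝ) + 1)⁻¹ • w), hM (x n)])
    · have h1 : Tendsto (fun n : ℕ => ((n : ℝ) + 1)⁻¹ • w) atTop (𝓝 0) := by
        have := (tendsto_one_div_add_atTop_nhds_zero_nat (𝕜 := ℝ)).smul_const w
        simpa using this
      have h2 : Tendsto (fun n : ℕ => u (x n - ((n : ℝ) + 1)⁻¹ • w) - u (x n)) atTop (𝓝 0) := by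
        rw [Metric.tendsto_atTop]
        intro η hη
        obtain ⟨δ, hδ, h⟩ := Metric.uniformContinuous_iff.1 huc η hη
        obtain ⟨n₀, hn₀⟩ := Metric.tendsto_atTop.1 h1 δ hδ
        refine ⟨n₀, fun n hn => ?_⟩
        have := h (a := x n - ((n : ℝ) + 1)⁻¹ • w) (b := x n) (by
          simpa [dist_eq_norm] using hn₀ n hn)
        simpa [dist_eq_norm] using this
      simpa using h2.mul_const (κ w)
  rw [integral_zero] at hlim
  have hlim' := (hlim.const_mul (∫ z, κ z)⁻¹).norm
  rw [mul_zero, norm_zero] at hlim'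
  obtain ⟨n, hn⟩ := (hlim'.eventually (gt_mem_nhds hε)).exists
  have := hx n
  rw [key _ (by positivity)] at this
  exact lt_irrefl _ (this.trans hn)

/-- Convolution with a nonnegative kernel preserves semiconvexity inequalities. -/
theorem convolution_semiconvex {d : ℕ} {u k : EuclideanSpace ℝ (Fin d) → ℝ}
    (hu : Continuous u) (hc : HasCompactSupport u) (hk : Continuous k) (hk0 : ∀ x, 0 ≤ k x)
    {s : Set (EuclideanSpace ℝ (Fin d))} (hs : IsCompact s)
    {x y : EuclideanSpace ℝ (Fin d)} {a b : ℝ} {t : ℝ}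
    (hgap : ∀ z, u (a • x + b • y - z) ≤ a * u (x - z) + b * u (y - z)
      + s.indicator (fun _ => t) (a • x + b • y - z)) :
    ∫ z, u z * k (a • x + b • y - z) ≤ a * (∫ z, u z * k (x - z)) + b * (∫ z, u z * k (y - z))
      + t * ∫ z in s, k (a • x + b • y - z) := by
  set c := a • x + b • y with hcdef
  have hint : ∀ w, Integrable fun z => u (w - z) * k z := fun w =>
    Continuous.integrable_of_hasCompactSupport (by fun_prop)
      (hc.comp_homeomorph (Homeomorph.subLeft w)).mul_right
  have h1 : t * ∫ z in s, k (c - z) = ∫ z, s.indicator (fun _ => t) (c - z) * k z := by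
    rw [← integral_mul_comp_sub_left (s.indicator fun _ => t) k, ← integral_const_mul,
      ← integral_indicator hs.measurableSet]
    congr 1; ext z
    by_cases hz : z ∈ s <;> simp [hz]
  have h2 : Integrable fun z => s.indicator (fun _ => t) (c - z) * k z := by
    have h3 : Integrable (s.indicator fun z => t * k (c - z)) := by
      rw [integrable_indicator_iff hs.measurableSet]
      exact ContinuousOn.integrableOn_compact hs (by fun_prop)
    refine (h3.comp_sub_left c).congr (.of_forall fun z => ?_)
    by_cases hz : c - z ∈ s <;> simp [hz]
  have h4 : Integrable fun z => a * (u (x - z) * k z) + b * (u (y - z) * k z) :=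
    ((hint x).const_mul a).add ((hint y).const_mul b)
  rw [integral_mul_comp_sub_left, integral_mul_comp_sub_left, integral_mul_comp_sub_left, h1,
    ← integral_const_mul, ← integral_const_mul, ← integral_add ((hint x).const_mul a)
      ((hint y).const_mul b), ← integral_add h4 h2]
  refine integral_mono (hint c) (h4.add h2) fun z => ?_
  have := mul_le_mul_of_nonneg_right (hgap z) (hk0 z)
  linarith

/-! ### Radial convex functions -/

theorem norm_sq_convex_combination {E : Type*} [NormedAddCommGroup E] [InnerProductSpace ℝ E]
    (x y : E) {a b : ℝ} (hab : a + b = 1) :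
    ‖a • x + b • y‖ ^ 2 + a * b * ‖x - y‖ ^ 2 = a * ‖x‖ ^ 2 + b * ‖y‖ ^ 2 := by
  obtain rfl : b = 1 - a := by linarith
  rw [norm_add_sq_real, norm_sub_sq_real, norm_smul, norm_smul, inner_smul_left, inner_smul_right,
    mul_pow, mul_pow, Real.norm_eq_abs, Real.norm_eq_abs, sq_abs, sq_abs]
  simp only [conj_trivial]
  ring

/-- The strong convexity of `‖x‖ ^ 2 * φ (‖x‖ ^ 2)` at a convex combination `c` of two points is
at least `φ (‖c‖ ^ 2)`. -/
theorem norm_sq_mul_strongly_convex {E : Type*} [NormedAddCommGroup E] [InnerProductSpace ℝ E]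
    {φ : ℝ → ℝ} (hmono : MonotoneOn φ (Set.Ici 0))
    (hconv : ConvexOn ℝ (Set.Ici 0) fun t => t * φ t)
    (x y : E) {a b : ℝ} (ha : 0 ≤ a) (hb : 0 ≤ b) (hab : a + b = 1) :
    ‖a • x + b • y‖ ^ 2 * φ (‖a • x + b • y‖ ^ 2) + a * b * ‖x - y‖ ^ 2 * φ (‖a • x + b • y‖ ^ 2)
      ≤ a * (‖x‖ ^ 2 * φ (‖x‖ ^ 2)) + b * (‖y‖ ^ 2 * φ (‖y‖ ^ 2)) := by
  have h1 := hconv.2 (x := ‖x‖ ^ 2) (y := ‖y‖ ^ 2) (Set.mem_Ici.2 (by positivity))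
    (Set.mem_Ici.2 (by positivity)) ha hb hab
  simp only [smul_eq_mul] at h1
  -- The averaged squared norm is `T = ‖c‖ ^ 2 + a * b * ‖x - y‖ ^ 2`; convexity bounds the right
  -- side below by `T * φ T`, and monotonicity gives `φ T ≥ φ (‖c‖ ^ 2)`.
  rw [← norm_sq_convex_combination x y hab] at h1
  have h0 : 0 ≤ a * b * ‖x - y‖ ^ 2 := by positivity
  have h2 := hmono (a := ‖a • x + b • y‖ ^ 2) (Set.mem_Ici.2 (by positivity))
    (b := ‖a • x + b • y‖ ^ 2 + a * b * ‖x - y‖ ^ 2) (Set.mem_Ici.2 (by positivity)) (by linarith)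
  refine le_trans ?_ h1
  rw [← add_mul]
  gcongr

/-! ### Polynomial kernels -/

/-- The nonnegative polynomial kernel obtained by truncating `c * sinc (N * ‖x‖) ^ (2 * d)`. -/
noncomputable def sincKernel (d : ℕ) (c N : ℝ) (m : ℕ) (x : EuclideanSpace ℝ (Fin d)) : ℝ :=
  c * sincTrunc m ((N * ‖x‖) ^ 2) ^ (2 * d)

theorem sincKernel_mem_polyFunctions (d : ℕ) (c N : ℝ) (m : ℕ) :
    sincKernel d c N m ∈ polyFunctions d := by
  have h1 : (fun x => (N * ‖x‖) ^ 2) ∈ polyFunctions d := by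
    simp_rw [mul_pow]
    exact mul_mem (const_mem_polyFunctions d (N ^ 2)) (norm_sq_mem_polyFunctions d)
  exact mul_mem (const_mem_polyFunctions d c)
    (pow_mem (powerSum_comp_mem_polyFunctions h1 m _) (2 * d))

theorem sincKernel_nonneg (d : ℕ) {c : ℝ} (hc : 0 ≤ c) (N : ℝ) (m : ℕ)
    (x : EuclideanSpace ℝ (Fin d)) : 0 ≤ sincKernel d c N m x := by
  unfold sincKernel
  rw [pow_mul]
  positivity

theorem sincKernel_le_majorant (d : ℕ) {c : ℝ} (hc : 0 ≤ c) {N : ℝ} (hN : 0 ≤ N) (m : ℕ)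
    {x : EuclideanSpace ℝ (Fin d)} {r : ℝ} (hr : ‖x‖ ≤ r) :
    sincKernel d c N m x ≤ c * sincMajorant m ((N * r) ^ 2) ^ (2 * d) := by
  unfold sincKernel
  have h1 : |sincTrunc m ((N * ‖x‖) ^ 2)| ≤ sincMajorant m ((N * r) ^ 2) :=
    (abs_sincTrunc_le m (by positivity)).trans (sincMajorant_mono m (by positivity) (by gcongr))
  rw [← Even.pow_abs (even_two_mul d)]
  gcongr

theorem majorant_pow_le_exp (m j : ℕ) {r : ℝ} (hr : 0 ≤ r) :
    sincMajorant m (r ^ 2) ^ j ≤ Real.exp (j * r) := by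
  rw [Real.exp_nat_mul]
  have := sincMajorant_nonneg m (sq_nonneg r)
  gcongr
  exact sincMajorant_sq_le_exp m hr

theorem exists_sincKernel_near (d : ℕ) {c : ℝ} (hc : 0 < c) {N : ℝ} (hN : 0 ≤ N) (R : ℝ)
    {η : ℝ} (hη : 0 < η) :
    ∃ m, ∀ x : EuclideanSpace ℝ (Fin d), ‖x‖ ≤ R →
      |sincKernel d c N m x - c * Real.sinc (N * ‖x‖) ^ (2 * d)| ≤ η := by
  obtain ⟨m, hm⟩ := exists_sincTrunc_pow_near (2 * d) (N * R) (div_pos hη hc)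
  refine ⟨m, fun x hx => ?_⟩
  unfold sincKernel
  rw [← mul_sub, abs_mul, abs_of_pos hc, mul_comm, ← le_div_iff₀ hc]
  exact hm _ ⟨by positivity, by gcongr⟩

theorem monotoneOn_mul_majorant (m j : ℕ) {C L : ℝ} (hC : 0 ≤ C) (hL : 0 ≤ L) :
    MonotoneOn (fun t => C * t * sincMajorant m (L * t) ^ j) (Set.Ici 0) := by
  intro s hs t ht hst
  have hs : 0 ≤ s := hs
  have ht : 0 ≤ t := ht
  have h := sincMajorant_nonneg m (mul_nonneg hL hs)
  have := sincMajorant_mono m (mul_nonneg hL hs) (mul_le_mul_of_nonneg_left hst hL)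
  dsimp only
  gcongr

/-- A product of nonnegative increasing convex functions is convex. Positive coefficients are
essential, which is why the correction uses the majorant and not the truncation itself. -/
theorem convexOn_mul_majorant (m j : ℕ) {C L : ℝ} (hC : 0 ≤ C) (hL : 0 ≤ L) :
    ConvexOn ℝ (Set.Ici 0) (fun t => t * (C * t * sincMajorant m (L * t) ^ j)) := by
  have h1 : ConvexOn ℝ (Set.Ici 0) fun t => sincMajorant m (L * t) := by
    refine ⟨convex_Ici 0, fun x hx y hy a b ha hb hab => ?_⟩
    have := (convexOn_sincMajorant m).2 (x := L * x) (y := L * y) (mul_nonneg hL hx)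
      (mul_nonneg hL hy) ha hb hab
    simp only [smul_eq_mul] at this ⊢
    convert this using 2
    ring
  have h0 : ∀ t ∈ Set.Ici (0 : ℝ), 0 ≤ sincMajorant m (L * t) := fun t ht =>
    sincMajorant_nonneg m (mul_nonneg hL ht)
  have h2 : ConvexOn ℝ (Set.Ici 0) fun t => sincMajorant m (L * t) ^ j :=
    h1.pow (fun t ht => h0 t ht) j
  have h3 : ConvexOn ℝ (Set.Ici 0) fun t : ℝ => C * t ^ 2 := (convexOn_pow 2).smul hC
  have h4 := h3.mul h2 (fun t ht => by positivity) (fun t ht => pow_nonneg (h0 t ht) j)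
    (MonotoneOn.monovaryOn (s := Set.Ici 0)
      (fun s hs t ht hst => by
        have : (0 : ℝ) ≤ s := hs
        gcongr)
      (fun s hs t ht hst => by
        have := h0 s hs
        have := sincMajorant_mono m (mul_nonneg hL hs) (mul_le_mul_of_nonneg_left hst hL)
        gcongr))
  refine h4.congr fun t _ => ?_
  simp only [Pi.mul_apply]
  ring

/-! ### Convex polynomial approximation -/

set_option maxHeartbeats 1000000 in
/-- A function which differs from `‖x‖ ^ 2` by a compactly supported function, and which is
convex in the sense of `hgap`, can be approximated by convex polynomials. -/
theorem exists_convex_polyFun_near_norm_sq_add {d : ℕ} (hd : 1 ≤ d) {α : ℝ} (hα : 1 < α)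
    {u : EuclideanSpace ℝ (Fin d) → ℝ} (hu : Continuous u) {R : ℝ} (hR : 0 ≤ R)
    (hsupp : ∀ x, R < ‖x‖ → u x = 0)
    (hgap : ∀ x y : EuclideanSpace ℝ (Fin d), ∀ a b : ℝ, 0 ≤ a → 0 ≤ b → a + b = 1 →
      u (a • x + b • y) ≤ a * u x + b * u y
        + (Metric.closedBall 0 R).indicator (fun _ => a * b * ‖x - y‖ ^ 2) (a • x + b • y))
    {ε : ℝ} (hε : 0 < ε) :
    ∃ P : MvPolynomial (Fin d) ℝ, ConvexOn ℝ Set.univ (polyFun P) ∧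
      ∀ x, |‖x‖ ^ 2 + u x - polyFun P x| ≤ ε * Real.exp (‖x‖ ^ α / 2) := by
  have hR' : ∀ x, u x ≠ 0 → x ∈ Metric.closedBall 0 R := fun x hx => by
    rw [mem_closedBall_zero_iff]
    by_contra! h
    exact hx (hsupp x h)
  have hcs : HasCompactSupport u :=
    HasCompactSupport.of_support_subset_isCompact (isCompact_closedBall 0 R) hR'
  set S : Set (EuclideanSpace ℝ (Fin d)) := Metric.closedBall 0 R with hS
  have hScomp : IsCompact S := isCompact_closedBall 0 R
  have hSm : MeasurableSet S := hScomp.measurableSet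
  have hSfin : volume S ≠ ∞ := hScomp.measure_lt_top.ne
  set v := volume.real S with hv
  have hv0 : 0 ≤ v := measureReal_nonneg
  obtain ⟨M, hM⟩ := hcs.exists_bound_of_continuous hu
  have hM0 : 0 ≤ M := (norm_nonneg _).trans (hM 0)
  -- reduction of integrals against `u` to integrals over `S`
  have hbound : ∀ (k : EuclideanSpace ℝ (Fin d) → ℝ) (T : ℝ), (∀ y ∈ S, |k y| ≤ T) →
      |∫ y, u y * k y| ≤ M * v * T := by
    intro k T hk
    have h1 : ∫ y, u y * k y = ∫ y in S, u y * k y := by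
      rw [setIntegral_eq_integral_of_forall_compl_eq_zero]
      intro y hy
      rw [not_imp_comm.1 (hR' y) hy, zero_mul]
    rw [h1]
    have h2 := norm_setIntegral_le_of_norm_le_const (μ := volume) (s := S) (C := M * T)
      hScomp.measure_lt_top (f := fun y => u y * k y) (fun y hy => by
        rw [norm_mul]
        exact mul_le_mul (hM y) (hk y hy) (norm_nonneg _) hM0)
    rw [Real.norm_eq_abs] at h2
    calc _ ≤ _ := h2
      _ = M * v * T := by rw [← hv]; ring
  -- Four errors: the `δ` term, the `φ` term, the convolution with the exact kernel, and the
  -- truncation.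
  set ε' := ε / 4 with hε'
  have hε'0 : 0 < ε' := by positivity
  have hI := integral_sinc_norm_pow_pos hd
  set I := ∫ x : EuclideanSpace ℝ (Fin d), Real.sinc ‖x‖ ^ (2 * d) with hIdef
  obtain ⟨N, hN, hNu⟩ := exists_dilation_convolution_near (integrable_sinc_norm_pow hd) hI hu hcs
    hε'0
  set c := N ^ d / I with hc
  have hc0 : 0 < c := by positivity
  have hNu' : ∀ x, |(∫ y, u y * (c * Real.sinc (N * ‖x - y‖) ^ (2 * d))) - u x| ≤ ε' := by
    intro x
    have := hNu x
    simpa only [norm_smul, Real.norm_of_nonneg hN.le] using this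
  clear hNu
  -- the correction term
  set L := N * (1 + R) with hL
  have hL0 : 0 ≤ L := by positivity
  obtain ⟨C₁, hC₁, hg1⟩ := exp_mul_le_mul_exp_rpow hα (4 + (2 * d : ℕ) * L)
  obtain ⟨C₂, hC₂, hg2⟩ := exp_mul_le_mul_exp_rpow hα 2
  set δ := ε' / C₂ with hδ
  have hδ0 : 0 < δ := by positivity
  -- With `K = c * v / ρ ^ 2`, the correction `K * t` reaches the needed `c * v` once `t ≥ ρ ^ 2`,
  -- while `K * C₁ ≤ ε'` keeps it small against `V`.
  set ρ := 1 + c * v * C₁ / ε' with hρ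
  have hρ1 : 1 ≤ ρ := by rw [hρ]; linarith [show 0 ≤ c * v * C₁ / ε' by positivity]
  set K := c * v / ρ ^ 2 with hK
  have hK0 : 0 ≤ K := by positivity
  have hKC : K * C₁ ≤ ε' := by
    rw [hK, div_mul_eq_mul_div, div_le_iff₀ (by positivity)]
    calc c * v * C₁ = ε' * (c * v * C₁ / ε') := by field_simp
      _ ≤ ε' * ρ := by gcongr; rw [hρ]; linarith
      _ ≤ ε' * ρ ^ 2 := by gcongr; nlinarith
  set D := M * v * (2 * c * Real.exp ((2 * d : ℕ) * N * R)) with hD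
  have hD0 : 0 ≤ D := by positivity
  obtain ⟨ρ₂, hρ₂, hg3⟩ := exp_mul_le_small_mul_exp_rpow hα ((2 * d : ℕ) * N)
    (show 0 < ε' / (D + 1) by positivity)
  -- the degree of truncation
  set η := min (δ / (v + 1)) (ε' / (M * v + 1)) with hη
  have hη0 : 0 < η := by positivity
  have hη1 : v * η ≤ δ := by
    calc v * η ≤ (v + 1) * (δ / (v + 1)) := by
          gcongr
          · linarith
          · exact min_le_left _ _
      _ = δ := by field_simp
  have hη2 : M * v * η ≤ ε' := by
    calc M * v * η ≤ (M * v + 1) * (ε' / (M * v + 1)) := by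
          gcongr
          · linarith
          · exact min_le_right _ _
      _ = ε' := by field_simp
  -- The radius covers `x - y` for `y ∈ S` and `‖x‖` up to `ρ` (for convexity) or `ρ₂` (for
  -- approximation).
  obtain ⟨m, hm⟩ := exists_sincKernel_near d hc0 hN.le (max ρ ρ₂ + R) hη0
  set k := sincKernel d c N m with hk
  set φ : ℝ → ℝ := fun t => K * t * sincMajorant m (L ^ 2 * t) ^ (2 * d) with hφ
  have hφ0 : ∀ t, 0 ≤ t → 0 ≤ φ t := fun t ht => by
    have := sincMajorant_nonneg m (mul_nonneg (sq_nonneg L) ht)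
    simp only [hφ]; positivity
  obtain ⟨Q, hQ⟩ := sincKernel_mem_polyFunctions d c N m
  have hkcont : Continuous k := by rw [hk, ← hQ]; exact continuous_polyFun Q
  have hk0 : ∀ x, 0 ≤ k x := sincKernel_nonneg d hc0.le N m
  have hPmem : (fun x => (1 + δ) * ‖x‖ ^ 2 + ‖x‖ ^ 2 * φ (‖x‖ ^ 2) + ∫ y, u y * k (x - y))
      ∈ polyFunctions d := by
    have h2 := norm_sq_mem_polyFunctions d
    have h3 : (fun x => φ (‖x‖ ^ 2)) ∈ polyFunctions d :=
      mul_mem (mul_mem (const_mem_polyFunctions d K) h2) (pow_mem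
        (powerSum_comp_mem_polyFunctions (mul_mem (const_mem_polyFunctions d (L ^ 2)) h2) m _) _)
    have h4 := integral_mul_polyFun_sub_mem_polyFunctions Q hu hcs
    rw [hQ] at h4
    exact add_mem (add_mem (mul_mem (const_mem_polyFunctions d (1 + δ)) h2) (mul_mem h2 h3)) h4
  obtain ⟨P, hP⟩ := hPmem
  refine ⟨P, ?_, ?_⟩
  · -- convexity
    have hmass : ∀ x, ∫ y in S, k (x - y) ≤ 1 + δ + φ (‖x‖ ^ 2) := by
      intro x
      have hint1 : IntegrableOn (fun y => k (x - y)) S :=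
        ContinuousOn.integrableOn_compact hScomp (by fun_prop)
      -- Near the origin `k` is within `η` of a kernel of total mass one; far away the majorant
      -- bounds `k`, and `φ` dominates.
      rcases le_total ‖x‖ ρ with hx | hx
      · have hs := integrable_sinc_norm_pow hd
        have hsc := Real.continuous_sinc
        have hint0 : Integrable (fun z : EuclideanSpace ℝ (Fin d) =>
            c * Real.sinc (N * ‖z‖) ^ (2 * d)) := by
          have := (hs.comp_smul hN.ne').const_mul c
          simpa only [norm_smul, Real.norm_of_nonneg hN.le] using this
        have htot : ∫ z : EuclideanSpace ℝ (Fin d), c * Real.sinc (N * ‖z‖) ^ (2 * d) = 1 := by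
          have := Measure.integral_comp_smul (volume : Measure (EuclideanSpace ℝ (Fin d)))
            (fun w => Real.sinc ‖w‖ ^ (2 * d)) N
          simp only [norm_smul, Real.norm_of_nonneg hN.le, finrank_euclideanSpace,
            Fintype.card_fin, smul_eq_mul] at this
          rw [integral_const_mul, this, abs_of_nonneg (by positivity), hc, ← hIdef]
          field_simp
        have hle : ∫ y in S, c * Real.sinc (N * ‖x - y‖) ^ (2 * d) ≤ 1 := by
          rw [← htot, ← integral_sub_left_eq_self
            (fun z : EuclideanSpace ℝ (Fin d) => c * Real.sinc (N * ‖z‖) ^ (2 * d)) volume x]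
          refine setIntegral_le_integral (hint0.comp_sub_left x) (.of_forall fun y => ?_)
          simp only [Pi.zero_apply, pow_mul]
          positivity
        have hint2 : IntegrableOn (fun y => c * Real.sinc (N * ‖x - y‖) ^ (2 * d)) S :=
          (hint0.comp_sub_left x).integrableOn
        have hint3 : IntegrableOn (fun _ : EuclideanSpace ℝ (Fin d) => η) S :=
          integrableOn_const hSfin
        calc ∫ y in S, k (x - y)
            ≤ ∫ y in S, (c * Real.sinc (N * ‖x - y‖) ^ (2 * d) + η) := by
              refine setIntegral_mono_on hint1 (hint2.add hint3) hSm fun y hy => ?_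
              have h1 : ‖x - y‖ ≤ max ρ ρ₂ + R := (norm_sub_le _ _).trans
                (add_le_add (hx.trans (le_max_left _ _)) (mem_closedBall_zero_iff.1 hy))
              linarith [(abs_le.1 (hm _ h1)).2]
          _ = (∫ y in S, c * Real.sinc (N * ‖x - y‖) ^ (2 * d)) + v * η := by
              rw [integral_add hint2 hint3, setIntegral_const, smul_eq_mul]
          _ ≤ 1 + δ + φ (‖x‖ ^ 2) := by
              have := hφ0 (‖x‖ ^ 2) (by positivity)
              linarith
      · have hx1 : 1 ≤ ‖x‖ := hρ1.trans hx
        have hb : ∀ y ∈ S, k (x - y) ≤ c * sincMajorant m (L ^ 2 * ‖x‖ ^ 2) ^ (2 * d) := by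
          intro y hy
          have h1 : ‖x - y‖ ≤ (1 + R) * ‖x‖ := by
            have := norm_sub_le x y
            have : ‖y‖ ≤ R := mem_closedBall_zero_iff.1 hy
            nlinarith
          have := sincKernel_le_majorant d hc0.le hN.le m h1
          rwa [show (N * ((1 + R) * ‖x‖)) ^ 2 = L ^ 2 * ‖x‖ ^ 2 by rw [hL]; ring] at this
        have hint3 : IntegrableOn (fun _ : EuclideanSpace ℝ (Fin d) =>
            c * sincMajorant m (L ^ 2 * ‖x‖ ^ 2) ^ (2 * d)) S := integrableOn_const hSfin
        have hmaj := sincMajorant_nonneg m (mul_nonneg (sq_nonneg L) (sq_nonneg ‖x‖))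
        calc ∫ y in S, k (x - y)
            ≤ ∫ y in S, c * sincMajorant m (L ^ 2 * ‖x‖ ^ 2) ^ (2 * d) :=
              setIntegral_mono_on hint1 hint3 hSm hb
          _ = c * v * sincMajorant m (L ^ 2 * ‖x‖ ^ 2) ^ (2 * d) := by
              rw [setIntegral_const, smul_eq_mul]; ring
          _ ≤ φ (‖x‖ ^ 2) := by
              refine mul_le_mul_of_nonneg_right ?_ (by positivity)
              calc c * v = K * ρ ^ 2 := by rw [hK, div_mul_cancel₀ _ (by positivity)]
                _ ≤ K * ‖x‖ ^ 2 := by gcongr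
          _ ≤ 1 + δ + φ (‖x‖ ^ 2) := by linarith
    refine ⟨convex_univ, fun x _ y _ a b ha hb hab => ?_⟩
    rw [hP]
    simp only [smul_eq_mul]
    have h1 := norm_sq_convex_combination x y hab
    have h2 := norm_sq_mul_strongly_convex (φ := φ) (monotoneOn_mul_majorant m (2 * d) hK0 (sq_nonneg L))
      (convexOn_mul_majorant m (2 * d) hK0 (sq_nonneg L)) x y ha hb hab
    have h3 := convolution_semiconvex hu hcs hkcont hk0 hScomp (x := x) (y := y) (a := a) (b := b)
      (t := a * b * ‖x - y‖ ^ 2) (fun z => by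
        have := hgap (x - z) (y - z) a b ha hb hab
        rw [show a • (x - z) + b • (y - z) = a • x + b • y - z by
          rw [smul_sub, smul_sub, sub_add_sub_comm, ← add_smul, hab, one_smul], sub_sub_sub_cancel_right] at this
        exact this)
    have h4 := mul_le_mul_of_nonneg_left (hmass (a • x + b • y))
      (show 0 ≤ a * b * ‖x - y‖ ^ 2 by positivity)
    have h5 := congrArg ((1 + δ) * ·) h1
    linarith
  · -- approximation
    intro x
    rw [hP]
    set V := Real.exp (‖x‖ ^ α / 2) with hV
    have hV1 : 1 ≤ V := one_le_exp_rpow_div_two α (norm_nonneg x)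
    have hr : 0 ≤ ‖x‖ := norm_nonneg x
    have e1 : δ * ‖x‖ ^ 2 ≤ ε' * V := by
      calc δ * ‖x‖ ^ 2 ≤ δ * Real.exp ‖x‖ ^ 2 := by gcongr; exact le_exp_self _
        _ = δ * Real.exp (2 * ‖x‖) := by rw [← Real.exp_nat_mul]; norm_cast
        _ ≤ δ * (C₂ * V) := by gcongr; exact hg2 _ hr
        _ = ε' * V := by rw [hδ]; field_simp
    have e2 : ‖x‖ ^ 2 * φ (‖x‖ ^ 2) ≤ ε' * V := by
      have h1 : sincMajorant m (L ^ 2 * ‖x‖ ^ 2) ^ (2 * d) ≤ Real.exp ((2 * d : ℕ) * (L * ‖x‖)) := by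
        rw [← mul_pow]
        exact majorant_pow_le_exp m (2 * d) (by positivity)
      calc ‖x‖ ^ 2 * φ (‖x‖ ^ 2)
          = K * (‖x‖ ^ 4 * sincMajorant m (L ^ 2 * ‖x‖ ^ 2) ^ (2 * d)) := by
            simp only [hφ]; ring
        _ ≤ K * (Real.exp ‖x‖ ^ 4 * Real.exp ((2 * d : ℕ) * (L * ‖x‖))) := by
            have := sincMajorant_nonneg m (mul_nonneg (sq_nonneg L) (sq_nonneg ‖x‖))
            gcongr
            exact le_exp_self _
        _ = K * Real.exp ((4 + (2 * d : ℕ) * L) * ‖x‖) := by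
            rw [← Real.exp_nat_mul, ← Real.exp_add]
            push_cast
            ring_nf
        _ ≤ K * (C₁ * V) := by gcongr; exact hg1 _ hr
        _ = (K * C₁) * V := by ring
        _ ≤ ε' * V := by gcongr
    have e3 := hNu' x
    have e4 : |(∫ y, u y * k (x - y)) - ∫ y, u y * (c * Real.sinc (N * ‖x - y‖) ^ (2 * d))|
        ≤ ε' * V := by
      have hsc := Real.continuous_sinc
      have hi1 : Integrable fun y => u y * k (x - y) :=
        Continuous.integrable_of_hasCompactSupport (by fun_prop) hcs.mul_right
      have hi2 : Integrable fun y => u y * (c * Real.sinc (N * ‖x - y‖) ^ (2 * d)) :=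
        Continuous.integrable_of_hasCompactSupport (by fun_prop) hcs.mul_right
      rw [← integral_sub hi1 hi2]
      simp_rw [← mul_sub]
      -- Up to `ρ₂` the truncation is accurate; beyond it both kernels are bounded by exponentials
      -- negligible against `V`.
      rcases le_total ‖x‖ ρ₂ with hx | hx
      · refine (hbound _ η fun y hy => hm _ ?_).trans ?_
        · exact (norm_sub_le _ _).trans
            (add_le_add (hx.trans (le_max_right _ _)) (mem_closedBall_zero_iff.1 hy))
        · nlinarith
      · refine (hbound _ (2 * c * Real.exp ((2 * d : ℕ) * (N * (‖x‖ + R)))) fun y hy => ?_).trans ?_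
        · have h1 : ‖x - y‖ ≤ ‖x‖ + R := (norm_sub_le _ _).trans
            (add_le_add le_rfl (mem_closedBall_zero_iff.1 hy))
          have h2 := sincKernel_le_majorant d hc0.le hN.le m h1
          have h3 := majorant_pow_le_exp m (2 * d) (show 0 ≤ N * (‖x‖ + R) by positivity)
          have h4 : Real.sinc (N * ‖x - y‖) ^ (2 * d) ≤ 1 := by
            rw [← Even.pow_abs (even_two_mul d)]
            exact pow_le_one₀ (abs_nonneg _) (Real.abs_sinc_le_one _)
          have h5 : 0 ≤ Real.sinc (N * ‖x - y‖) ^ (2 * d) := by rw [pow_mul]; positivity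
          have h6 : 1 ≤ Real.exp ((2 * d : ℕ) * (N * (‖x‖ + R))) :=
            Real.one_le_exp (by positivity)
          have h7 := hk0 (x - y)
          have h8 : k (x - y) ≤ c * Real.exp ((2 * d : ℕ) * (N * (‖x‖ + R))) :=
            h2.trans (by gcongr)
          have h9 : c * Real.sinc (N * ‖x - y‖) ^ (2 * d)
              ≤ c * Real.exp ((2 * d : ℕ) * (N * (‖x‖ + R))) := by
            gcongr; linarith
          have h10 : 0 ≤ c * Real.sinc (N * ‖x - y‖) ^ (2 * d) := by positivity
          rw [abs_le]
          constructor <;> linarith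
        · calc M * v * (2 * c * Real.exp ((2 * d : ℕ) * (N * (‖x‖ + R))))
              = D * Real.exp ((2 * d : ℕ) * N * ‖x‖) := by
                rw [hD, mul_assoc (M * v), mul_assoc (2 * c), ← Real.exp_add]
                ring_nf
            _ ≤ D * (ε' / (D + 1) * V) := by gcongr; exact hg3 _ hx
            _ ≤ (D + 1) * (ε' / (D + 1) * V) := by gcongr; linarith
            _ = ε' * V := by field_simp
    have e5 : 0 ≤ ‖x‖ ^ 2 * φ (‖x‖ ^ 2) := mul_nonneg (by positivity) (hφ0 _ (by positivity))
    have e6 : 0 ≤ δ * ‖x‖ ^ 2 := by positivity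
    have e7 : ε' ≤ ε' * V := le_mul_of_one_le_right hε'0.le hV1
    have e8 : ε * V = 4 * (ε' * V) := by rw [hε']; ring
    rw [abs_le] at e3 e4 ⊢
    rw [e8]
    constructor <;> linarith

/-- A convex function of at most linear growth can be approximated by convex polynomials. -/
theorem exists_convex_polyFun_near_of_linear_growth {d : ℕ} (hd : 1 ≤ d) {α : ℝ} (hα : 1 < α)
    {g : EuclideanSpace ℝ (Fin d) → ℝ} (hg : ConvexOn ℝ Set.univ g) (hgc : Continuous g) {B : ℝ}
    (hB : ∀ x, |g x| ≤ B * (1 + ‖x‖)) {ε : ℝ} (hε : 0 < ε) :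
    ∃ P : MvPolynomial (Fin d) ℝ, ConvexOn ℝ Set.univ (polyFun P) ∧
      ∀ x, |g x - polyFun P x| ≤ ε * Real.exp (‖x‖ ^ α / 2) := by
  have hB0 : 0 ≤ B := by simpa using (abs_nonneg _).trans (hB 0)
  have hε2 : 0 < ε / 2 := by positivity
  -- Chosen for `‖x‖ ^ 2 + |g x| ≤ (1 + 2 * B) * exp (2 * ‖x‖)`, which controls the error where `‖x‖
  -- ^ 2` exceeds `g + C₀`.
  obtain ⟨C, hC, hCg⟩ := exp_mul_le_small_mul_exp_rpow_add hα (show (0 : ℝ) ≤ 2 by norm_num)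
    (show 0 < ε / 2 / (1 + 2 * B) by positivity)
  set C₀ := (1 + 2 * B) * C with hC₀
  have hC₀0 : 0 < C₀ := by positivity
  set u : EuclideanSpace ℝ (Fin d) → ℝ := fun x => max (g x - ‖x‖ ^ 2 + C₀) 0 with hu
  have hR0 : 0 ≤ 1 + 2 * B + C₀ := by positivity
  obtain ⟨P, hPc, hP⟩ := exists_convex_polyFun_near_norm_sq_add hd hα (u := u) (by fun_prop) hR0
    (fun x hx => by
      refine max_eq_right ?_
      have := (abs_le.1 (hB x)).2
      nlinarith)
    (fun x y a b ha hb hab => by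
      have hux' := le_max_left (g x - ‖x‖ ^ 2 + C₀) 0
      have huy' := le_max_left (g y - ‖y‖ ^ 2 + C₀) 0
      have hind : 0 ≤ (Metric.closedBall (0 : EuclideanSpace ℝ (Fin d)) (1 + 2 * B + C₀)).indicator
          (fun _ => a * b * ‖x - y‖ ^ 2) (a • x + b • y) :=
        Set.indicator_nonneg (fun _ _ => by positivity) _
      refine max_le ?_ (by simp only [hu]; positivity)
      -- Inside the ball the defect comes from `-‖x‖ ^ 2` alone; outside, `g + C₀ ≤ ‖x‖ ^ 2` at the
      -- combination, while `u ≥ 0` everywhere.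
      by_cases hz : a • x + b • y ∈ Metric.closedBall (0 : EuclideanSpace ℝ (Fin d)) (1 + 2 * B + C₀)
      · rw [Set.indicator_of_mem hz]
        have h1 := hg.2 (Set.mem_univ x) (Set.mem_univ y) ha hb hab
        have h2 := norm_sq_convex_combination x y hab
        have h3 := mul_le_mul_of_nonneg_left hux' ha
        have h4 := mul_le_mul_of_nonneg_left huy' hb
        simp only [smul_eq_mul] at h1
        simp only [hu]
        have h5 : C₀ = a * C₀ + b * C₀ := by rw [← add_mul, hab, one_mul]
        linarith
      · rw [mem_closedBall_zero_iff, not_le] at hz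
        have h1 := (abs_le.1 (hB (a • x + b • y))).2
        have h2 : 0 ≤ a * u x + b * u y := by simp only [hu]; positivity
        nlinarith) hε2
  refine ⟨P - MvPolynomial.C C₀, ?_, fun x => ?_⟩
  · have : polyFun (P - MvPolynomial.C C₀) = fun x => polyFun P x + -C₀ := by
      ext x; simp [polyFun, sub_eq_add_neg]
    rw [this]
    exact hPc.add (convexOn_const _ convex_univ)
  · have h1 : polyFun (P - MvPolynomial.C C₀) x = polyFun P x - C₀ := by simp [polyFun]
    rw [h1]
    have h2 := hP x
    have h3 : |‖x‖ ^ 2 + u x - C₀ - g x| ≤ ε / 2 * Real.exp (‖x‖ ^ α / 2) := by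
      simp only [hu]
      rcases le_total 0 (g x - ‖x‖ ^ 2 + C₀) with h | h
      · rw [max_eq_left h]
        ring_nf
        simp only [abs_zero]
        positivity
      · rw [max_eq_right h, abs_of_nonneg (by linarith)]
        have h4 := (abs_le.1 (hB x)).1
        have h5 := hCg ‖x‖ (norm_nonneg x)
        have h6 : ‖x‖ ^ 2 ≤ Real.exp (2 * ‖x‖) := by
          have : Real.exp (2 * ‖x‖) = Real.exp ‖x‖ ^ 2 := by rw [← Real.exp_nat_mul]; norm_cast
          rw [this]
          gcongr
          exact le_exp_self _
        have h7 : 1 + ‖x‖ ≤ 2 * Real.exp (2 * ‖x‖) := by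
          have := Real.add_one_le_exp (2 * ‖x‖)
          have := norm_nonneg x
          linarith
        have h8 : (1 + 2 * B) * (ε / 2 / (1 + 2 * B) * Real.exp (‖x‖ ^ α / 2) + C)
            = ε / 2 * Real.exp (‖x‖ ^ α / 2) + C₀ := by
          rw [hC₀]; field_simp
        have h9 := mul_le_mul_of_nonneg_left h5 (show 0 ≤ 1 + 2 * B by positivity)
        have h10 := mul_le_mul_of_nonneg_left h7 hB0
        linarith
    have h4 : g x - (polyFun P x - C₀)
        = (‖x‖ ^ 2 + u x - polyFun P x) - (‖x‖ ^ 2 + u x - C₀ - g x) := by ring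
    rw [h4]
    refine (abs_sub _ _).trans ?_
    linarith

/-! ### Reduction to convex functions of linear growth -/

/-- A continuous convex function is the monotone limit of convex functions of linear growth. -/
theorem exists_monotone_seq_linear_growth {d : ℕ} {f : EuclideanSpace ℝ (Fin d) → ℝ}
    (hf : ConvexOn ℝ Set.univ f) (hfc : Continuous f) :
    ∃ g : ℕ → EuclideanSpace ℝ (Fin d) → ℝ, Monotone g ∧ (∀ n, ConvexOn ℝ Set.univ (g n)) ∧
      (∀ n, Continuous (g n)) ∧ (∀ n, ∃ B : ℝ, ∀ x, |g n x| ≤ B * (1 + ‖x‖)) ∧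
      (∀ n, g n ≤ f) ∧ ∀ x, Tendsto (fun n => g n x) atTop (𝓝 (f x)) := by
  obtain ⟨l, c, hle, hsup⟩ := hf.real_univ_sSup_of_nat_affine_eq hfc.lowerSemicontinuous
  set a : ℕ → EuclideanSpace ℝ (Fin d) → ℝ := fun i x => l i x + c i with ha
  have hle' : ∀ i, a i ≤ f := hle
  have hsup' : ∀ x, ⨆ i, a i x = f x := by
    intro x
    rw [← hsup, iSup_apply]
    rfl
  have hacont : ∀ i, Continuous (a i) := fun i => by fun_prop
  have haconv : ∀ i, ConvexOn ℝ Set.univ (a i) := fun i =>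
    ((l i).toLinearMap.convexOn convex_univ).add (convexOn_const _ convex_univ)
  have hab : ∀ i, ∃ B : ℝ, ∀ x, |a i x| ≤ B * (1 + ‖x‖) := fun i => by
    refine ⟨‖l i‖ + |c i|, fun x => (abs_add_le _ _).trans ?_⟩
    have h1 : |l i x| ≤ ‖l i‖ * ‖x‖ := (l i).le_opNorm x
    have h2 : 0 ≤ |c i| * ‖x‖ := by positivity
    have h3 : 0 ≤ ‖l i‖ := norm_nonneg _
    linarith
  have hbdd : ∀ x, BddAbove (Set.range fun i => a i x) := fun x =>
    ⟨f x, by rintro _ ⟨i, rfl⟩; exact hle' i x⟩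
  have hgle : ∀ n, partialSups a n ≤ f := fun n => partialSups_le a n f fun i _ => hle' i
  refine ⟨partialSups a, (partialSups a).monotone, fun n => ?_, fun n => ?_, fun n => ?_, hgle,
    fun x => ?_⟩
  · induction n with
    | zero => simpa using haconv 0
    | succ n ih => rw [partialSups_add_one]; exact ih.sup (haconv _)
  · induction n with
    | zero => simpa using hacont 0
    | succ n ih => rw [partialSups_add_one]; exact ih.sup (hacont _)
  · induction n with
    | zero => simpa using hab 0
    | succ n ih =>
      rw [partialSups_add_one]
      obtain ⟨B, hB⟩ := ih
      obtain ⟨B', hB'⟩ := hab (n + 1)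
      refine ⟨max B B', fun x => ?_⟩
      rw [Pi.sup_apply]
      refine (abs_max_le_max_abs_abs).trans (max_le ((hB x).trans ?_) ((hB' x).trans ?_)) <;>
      gcongr
      · exact le_max_left _ _
      · exact le_max_right _ _
  · refine tendsto_atTop_isLUB (fun m n h => (partialSups a).monotone h x) ⟨?_, fun b hb => ?_⟩
    · rintro _ ⟨n, rfl⟩
      exact hgle n x
    · rw [← hsup' x]
      exact ciSup_le fun i => (le_partialSups a i x).trans (hb ⟨i, rfl⟩)

theorem tendsto_eLpNorm_of_dominated {X : Type*} [MeasurableSpace X] {μ : Measure X} {p : ℝ≥0∞}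
    (hp : p ≠ ∞) (hp0 : p ≠ 0) {F : ℕ → X → ℝ} {G : X → ℝ} (hG : MemLp G p μ)
    (hF : ∀ n, AEStronglyMeasurable (F n) μ) (hle : ∀ n x, |F n x| ≤ |G x|)
    (hlim : ∀ x, Tendsto (fun n => F n x) atTop (𝓝 0)) :
    Tendsto (fun n => eLpNorm (F n) p μ) atTop (𝓝 0) := by
  have hpr : 0 < p.toReal := ENNReal.toReal_pos hp0 hp
  simp_rw [eLpNorm_eq_lintegral_rpow_enorm_toReal hp0 hp]
  have h1 : Tendsto (fun n => ∫⁻ x, ‖F n x‖ₑ ^ p.toReal ∂μ) atTop (𝓝 (∫⁻ _, 0 ∂μ)) := by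
    refine tendsto_lintegral_of_dominated_convergence' (fun x => ‖G x‖ₑ ^ p.toReal)
      (fun n => (hF n).enorm.pow_const _) (fun n => .of_forall fun x => ?_) ?_
      (.of_forall fun x => ?_)
    · dsimp only
      gcongr
      rw [← ofReal_norm, ← ofReal_norm]
      exact ENNReal.ofReal_le_ofReal (hle n x)
    · exact (lintegral_rpow_enorm_lt_top_of_eLpNorm_lt_top hp0 hp hG.2).ne
    · have h := ((ENNReal.continuous_rpow_const (y := p.toReal)).comp
        (continuous_enorm (E := ℝ))).tendsto 0 |>.comp (hlim x)
      simpa [hpr, Function.comp_def] using h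
  have h2 := ((ENNReal.continuous_rpow_const (y := 1 / p.toReal)).tendsto _).comp h1
  simpa [hpr, Function.comp_def] using h2

theorem freudWeight_nonneg (d : ℕ) (α : ℝ) (x : EuclideanSpace ℝ (Fin d)) :
    0 ≤ freudWeight d α x := (Real.exp_pos _).le

theorem freudWeight_le_one (d : ℕ) (α : ℝ) (x : EuclideanSpace ℝ (Fin d)) :
    freudWeight d α x ≤ 1 := Real.exp_le_one_iff.2 (by
  have : 0 ≤ ‖x‖ ^ α := by positivity
  linarith)

theorem exp_mul_freudWeight (d : ℕ) (α : ℝ) (x : EuclideanSpace ℝ (Fin d)) :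
    Real.exp (‖x‖ ^ α / 2) * freudWeight d α x = Real.exp (-(‖x‖ ^ α / 2)) := by
  rw [freudWeight, ← Real.exp_add]
  ring_nf

theorem continuous_freudWeight (d : ℕ) {α : ℝ} (hα : 0 ≤ α) : Continuous (freudWeight d α) := by
  have := (Real.continuous_rpow_const hα).comp
    (continuous_norm (E := EuclideanSpace ℝ (Fin d)))
  unfold freudWeight
  fun_prop

theorem linear_growth_mul_freudWeight_le {d : ℕ} {α : ℝ} (hα : 1 < α)
    {g : EuclideanSpace ℝ (Fin d) → ℝ} {B : ℝ} (hB : ∀ x, |g x| ≤ B * (1 + ‖x‖)) :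
    ∃ C, ∀ x, |g x * freudWeight d α x| ≤ C * Real.exp (-(‖x‖ ^ α / 2)) := by
  have hB0 : 0 ≤ B := by simpa using (abs_nonneg _).trans (hB 0)
  obtain ⟨C, hC, h⟩ := exp_mul_le_mul_exp_rpow hα 1
  refine ⟨B * C, fun x => ?_⟩
  rw [abs_mul, abs_of_nonneg (freudWeight_nonneg d α x), ← exp_mul_freudWeight, ← mul_assoc]
  refine mul_le_mul_of_nonneg_right ((hB x).trans ?_) (freudWeight_nonneg d α x)
  rw [mul_assoc]
  gcongr
  have h1 := h ‖x‖ (norm_nonneg x)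
  rw [one_mul] at h1
  linarith [Real.add_one_le_exp ‖x‖]

theorem tendsto_exp_neg_norm_rpow {d : ℕ} {α : ℝ} (hα : 1 < α) :
    Tendsto (fun x : EuclideanSpace ℝ (Fin d) => Real.exp (-(‖x‖ ^ α / 2)))
      (comap (fun x => ‖x‖) atTop) (𝓝 0) := by
  have h1 : Tendsto (fun r : ℝ => Real.exp (-(r ^ α / 2))) atTop (𝓝 0) :=
    Real.tendsto_exp_neg_atTop_nhds_zero.comp
      ((tendsto_rpow_atTop (by linarith : 0 < α)).atTop_div_const two_pos)
  exact h1.comp tendsto_comap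

/-- Monotone approximations of `f` by functions of linear growth converge in the weighted norm. -/
theorem tendsto_eLpNorm_sub_mul_freudWeight {d : ℕ} {α : ℝ} (hα : 1 < α) {p : ℝ≥0∞} (hp : 1 ≤ p)
    {f : EuclideanSpace ℝ (Fin d) → ℝ} (hfc : Continuous f)
    (hfp : p ≠ ∞ → MemLp (fun x => f x * freudWeight d α x) p volume)
    (hftop : p = ∞ → f ∈ weightedC0 d (freudWeight d α))
    {g : ℕ → EuclideanSpace ℝ (Fin d) → ℝ} (hmono : Monotone g) (hgc : ∀ n, Continuous (g n))
    (hB : ∃ B : ℝ, ∀ x, |g 0 x| ≤ B * (1 + ‖x‖)) (hle : ∀ n, g n ≤ f)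
    (hlim : ∀ x, Tendsto (fun n => g n x) atTop (𝓝 (f x))) :
    Tendsto (fun n => eLpNorm (fun x => (f x - g n x) * freudWeight d α x) p volume)
      atTop (𝓝 0) := by
  have hW := continuous_freudWeight d (by linarith : 0 ≤ α)
  obtain ⟨B, hB⟩ := hB
  obtain ⟨C, hC⟩ := linear_growth_mul_freudWeight_le hα hB
  -- Since `g 0 ≤ g n ≤ f`, one function dominates all errors: it serves dominated convergence for
  -- `p < ∞` and the tail for `p = ∞`, where Dini's theorem handles the ball.
  have hdom : ∀ n x, |(f x - g n x) * freudWeight d α x|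
      ≤ |f x * freudWeight d α x - g 0 x * freudWeight d α x| := by
    intro n x
    rw [← sub_mul, abs_mul, abs_mul]
    have h1 := hle n x
    have h2 := hmono (Nat.zero_le n) x
    have h3 := hle 0 x
    rw [abs_of_nonneg (sub_nonneg.2 h1), abs_of_nonneg (sub_nonneg.2 h3)]
    gcongr
  rcases eq_or_ne p ∞ with rfl | hp'
  · obtain ⟨-, hf0⟩ := hftop rfl
    have hg0 : Tendsto (fun x => g 0 x * freudWeight d α x) (comap (fun x => ‖x‖) atTop) (𝓝 0) := by
      refine squeeze_zero_norm hC ?_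
      simpa using (tendsto_exp_neg_norm_rpow hα).const_mul C
    have hdiff := (hf0.sub hg0).norm
    rw [sub_zero, norm_zero] at hdiff
    rw [ENNReal.tendsto_nhds_zero]
    intro ε hε
    rcases eq_or_ne ε ∞ with rfl | hε'
    · exact .of_forall fun _ => le_top
    have hεr : 0 < ε.toReal := ENNReal.toReal_pos hε.ne' hε'
    obtain ⟨t, ht, hts⟩ := mem_comap.1 (hdiff.eventually (gt_mem_nhds hεr))
    obtain ⟨R, hR⟩ := mem_atTop_sets.1 ht
    have hunif : TendstoUniformlyOn g f atTop (Metric.closedBall 0 R) :=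
      Monotone.tendstoUniformlyOn_of_forall_tendsto (isCompact_closedBall 0 R)
        (fun n => (hgc n).continuousOn) (fun x _ m n h => hmono h x) hfc.continuousOn
        (fun x _ => hlim x)
    filter_upwards [Metric.tendstoUniformlyOn_iff.1 hunif ε.toReal hεr] with n hn
    rw [eLpNorm_exponent_top, ← ENNReal.ofReal_toReal hε']
    refine eLpNormEssSup_le_of_ae_bound (.of_forall fun x => ?_)
    rcases le_total R ‖x‖ with hx | hx
    · exact (hdom n x).trans (hts (hR _ hx)).le
    · have h1 : |f x - g n x| < ε.toReal := hn x (mem_closedBall_zero_iff.2 hx)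
      rw [norm_mul, Real.norm_eq_abs, Real.norm_of_nonneg (freudWeight_nonneg d α x)]
      exact (mul_le_of_le_one_right (abs_nonneg _) (freudWeight_le_one d α x)).trans h1.le
  · have hg0 : MemLp (fun x => g 0 x * freudWeight d α x) p volume :=
      ((memLp_exp_neg_norm_rpow hα hp).const_mul C).mono'
        ((hgc 0).mul hW).aestronglyMeasurable (.of_forall hC)
    refine tendsto_eLpNorm_of_dominated hp' (by positivity) ((hfp hp').sub hg0)
      (fun n => ((hfc.sub (hgc n)).mul hW).aestronglyMeasurable) hdom fun x => ?_
    simpa using ((hlim x).const_sub (f x)).mul_const (freudWeight d α x)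

theorem theorem1 (d : ℕ) (hd : 1 ≤ d) (α : ℝ) (hα : 1 < α) (p : ℝ≥0∞) (hp : 1 ≤ p)
    (f : EuclideanSpace ℝ (Fin d) → ℝ) (hf : ConvexOn ℝ Set.univ f)
    (hfp : p ≠ ∞ → MemLp (fun x => f x * freudWeight d α x) p volume)
    (hftop : p = ∞ → f ∈ weightedC0 d (freudWeight d α)) :
    Tendsto (fun n : ℕ => convexApproxError n d p (freudWeight d α) f) atTop (𝓝 0) := by
  have hfc : Continuous f := by
    rw [← continuousOn_univ]; exact hf.continuousOn isOpen_univ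
  have hW := continuous_freudWeight d (by linarith : 0 ≤ α)
  obtain ⟨g, hmono, hgconv, hgc, hgB, hle, hlim⟩ := exists_monotone_seq_linear_growth hf hfc
  have happrox := tendsto_eLpNorm_sub_mul_freudWeight hα hp hfc hfp hftop hmono hgc (hgB 0) hle hlim
  have hV := memLp_exp_neg_norm_rpow (d := d) hα hp
  rw [ENNReal.tendsto_nhds_zero] at happrox ⊢
  intro ε hε
  obtain ⟨n, hn⟩ := (happrox (ε / 2) (ENNReal.half_pos hε.ne')).exists
  obtain ⟨η, hη, hηV⟩ : ∃ η : ℝ, 0 < η ∧ ENNReal.ofReal η *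
      eLpNorm (fun x : EuclideanSpace ℝ (Fin d) => Real.exp (-(‖x‖ ^ α / 2))) p volume ≤ ε / 2 := by
    have h1 : Tendsto (fun η : ℝ => ENNReal.ofReal η *
        eLpNorm (fun x : EuclideanSpace ℝ (Fin d) => Real.exp (-(‖x‖ ^ α / 2))) p volume)
        (𝓝[>] 0) (𝓝 0) := by
      have h2 : Tendsto ENNReal.ofReal (𝓝[>] 0) (𝓝 0) := by
        simpa using (ENNReal.continuous_ofReal.tendsto 0).mono_left nhdsWithin_le_nhds
      simpa using ENNReal.Tendsto.mul_const h2 (Or.inr hV.2.ne)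
    obtain ⟨η, h3, h4⟩ := ((ENNReal.tendsto_nhds_zero.1 h1 (ε / 2)
      (ENNReal.half_pos hε.ne')).and self_mem_nhdsWithin).exists
    exact ⟨η, h4, h3⟩
  obtain ⟨B, hB⟩ := hgB n
  obtain ⟨P, hPconv, hP⟩ := exists_convex_polyFun_near_of_linear_growth hd hα (hgconv n) (hgc n)
    hB hη
  have hPc := continuous_polyFun P
  -- One good `P` suffices: it stays admissible for every larger degree bound.
  filter_upwards [eventually_ge_atTop P.totalDegree] with N hN
  refine (iInf₂_le P ⟨hN, hPconv⟩).trans ?_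
  have hsplit : (fun x => (f x - polyFun P x) * freudWeight d α x)
      = (fun x => (f x - g n x) * freudWeight d α x)
        + fun x => (g n x - polyFun P x) * freudWeight d α x := by
    ext x; simp only [Pi.add_apply]; ring
  rw [hsplit]
  refine (eLpNorm_add_le ((hfc.sub (hgc n)).mul hW).aestronglyMeasurable
    (((hgc n).sub hPc).mul hW).aestronglyMeasurable hp).trans ?_
  rw [← ENNReal.add_halves ε]
  refine add_le_add hn (le_trans ?_ hηV)
  refine eLpNorm_le_mul_eLpNorm_of_ae_le_mul (.of_forall fun x => ?_) p
  rw [Pi.mul_apply, Pi.sub_apply, norm_mul, Real.norm_eq_abs,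
    Real.norm_of_nonneg (freudWeight_nonneg d α x), Real.norm_of_nonneg (Real.exp_pos _).le,
    ← exp_mul_freudWeight, ← mul_assoc]
  exact mul_le_mul_of_nonneg_right (hP x) (freudWeight_nonneg d α x)
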